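/- **Setting.** Let $1\le m_0\le m$, let $A\in\mathbb R^{m\times d}$ have full rank $m$, and let $c\in\mathbb R^d$, $b\in\mathbb R^m$. For $v\in\mathbb R^m$ let $P(v)=\{x\in\mathbb R^d: Ax=v,\ x\ge 0\}$ and let $OPT(v)$ be the set of minimizers of $c^Tx$ over $P(v)$. A basis is a set $I\subseteq[d]$ of $m$ column indices such that $A_I$ is invertible; put $\lambda(I)=A_I^{-T}c_I$, and let $x(I,v)\in\mathbb R^d$ be equal to $A_I^{-1}v$ on $I$ and $0$ off $I$. The basis $I$ is dual feasible if $A^T\lambda(I)\le c$. Let $I_1,\dots,I_N$ be all the dual feasible bases, ordered so that $x(I_k,b)\ge 0$ if and only if $k\le K$. Assume: * (A2) $OPT(b)=\{x\}$, i.e. the program with right-hand side $b$ has a unique optimal solution $x=x^\star(b)$. * (B1) $b_n$ are random vectors in $\mathbb R^m$ whose last $m-m_0$ coordinates equal those of $b$, $r_n\to\infty$, and $G_n:=r_n(b_n-b)$ converges in distribution to $G=(G^{m_0},0)$, where $G^{m_0}$ is absolutely continuous with respect to Lebesgue measure on $\mathbb R^{m_0}$. * (B2) $\mathbb P(OPT(b_n)\ne\emptyset)\to1$.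 Let $x^\star(b_n)$ be any measurable choice of an element of $OPT(b_n)$ (on the event that this set is non-empty). Let $\mathrm{Pos}(x)=\{i:x_i>0\}$, let $U$ be the union of all dual feasible bases $I$ with $x(I,b)=x$, and let $\mathrm{TZ}(x)=[d]\setminus U$ (true zeros) and $\mathrm{DZ}(x)=U\setminus\mathrm{Pos}(x)$ (degenerate zeros). **Theorem, part 1.** $$\lim_{n\to\infty}\mathbb P\big(x^\star_i(b_n)=0\ \text{ for all } i\in \mathrm{TZ}(x)\big)=1,\qquad \lim_{n\to\infty}\mathbb P\big(x^\star_i(b_n)>0\ \text{ for all } i\in \mathrm{Pos}(x)\big)=1.$$ **Theorem, part 2.** Assume further that $m_0=m$. For $k\le K$ write $I_k=\{i^k_1<\dots<i^k_m\}$ and $$H_k=\{v\in\mathbb R^m:(A_{I_k}^{-1}v)_j\ge 0\ \text{ for all } j \text{ with } i^k_j\notin\mathrm{Pos}(x)\},$$ and for non-empty $\mathcal K\subseteq[K]$ let $R_{\mathcal K}=\bigcap_{k\in\mathcal K}H_k\setminus\bigcup_{k\in[K]\setminus\mathcal K}H_k$ and let $\Delta_{\mathcal K}$ be the unit simplex in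 $\mathbb R^{\mathcal K}$. For each such $\mathcal K$ let $\alpha_n^{\mathcal K}$ be random vectors in $\Delta_{\mathcal K}$ with $x^\star(b_n)=\sum_{k\in\mathcal K}(\alpha_n^{\mathcal K})_k\,x(I_k,b_n)$ on the event that $\mathcal K=\{k\in[N]: x(I_k,b_n)\ge0\}$, and assume that $(\alpha_n^{\mathcal K},G_n)$ converges jointly in distribution to $(\alpha^{\mathcal K},G)$, with $\alpha^{\mathcal K}$ in $\Delta_{\mathcal K}$. Put $$M(G)=\sum_{\emptyset\ne\mathcal K\subseteq[K]}\mathbf 1_{\{G\in R_{\mathcal K}\}}\sum_{k\in\mathcal K}\alpha^{\mathcal K}_k\,x(I_k,G).$$ Consider the condition * (NC) for every non-empty $\mathcal K\subseteq[K]$ with $\mathbb P(G\in R_{\mathcal K})>0$, the conditional law of $\alpha^{\mathcal K}$ given $G\in R_{\mathcal K}$ is not concentrated on a proper face of $\Delta_{\mathcal K}$. If the Lebesgue density of $G$ is positive (almost everywhere) in a neighborhood of the origin and (NC) holds, then $$\mathbb P\big([M(G)]_i>0\big)>0\qquad\text{for every } i\in\mathrm{DZ}(x).$$ Moreover, (NC)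 holds automatically if $\lambda(I_j)\ne\lambda(I_k)$ for all $1\le j<k\le K$. -/

import Mathlib

open MeasureTheory ProbabilityTheory Filter Topology Matrix

namespace StochLP

noncomputable section

/-- The feasible set `P(v)` of the standard linear program `min cᵀ x` s.t. `A x = v`, `x ≥ 0`. -/
def feasibleSet {m d : ℕ} (A : Matrix (Fin m) (Fin d) ℝ) (v : Fin m → ℝ) : Set (Fin d → ℝ) :=
  {x | A *ᵥ x = v ∧ 0 ≤ x}

/-- The set `OPT(v)` of optimal solutions: the feasible points that minimize `cᵀ x` over `P(v)`. -/
def optSet {m d : ℕ} (A : Matrix (Fin m) (Fin d) ℝ) (c : Fin d → ℝ) (v : Fin m → ℝ) :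
    Set (Fin d → ℝ) :=
  {x | x ∈ feasibleSet A v ∧ ∀ y ∈ feasibleSet A v, c ⬝ᵥ x ≤ c ⬝ᵥ y}

/-- A basis of `A`: a set `I` of `m` column indices for which the `m × m` submatrix `A_I`
formed by these columns (in increasing order) is invertible. -/
@[ext] structure LPBasis {m d : ℕ} (A : Matrix (Fin m) (Fin d) ℝ) where
  idx : Finset (Fin d)
  card_idx : idx.card = m
  isUnit_det : IsUnit (A.submatrix id (idx.orderEmbOfFin card_idx)).det

namespace LPBasis

variable {m d : ℕ} {A : Matrix (Fin m) (Fin d) ℝ}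

instance : Fintype (LPBasis A) :=
  Fintype.ofInjective (fun I : LPBasis A => I.idx) (fun _ _ h => LPBasis.ext h)

/-- The increasing enumeration `j ↦ i_j` of `I = {i_1 < ... < i_m}`. -/
def emb (I : LPBasis A) : Fin m ↪o Fin d := I.idx.orderEmbOfFin I.card_idx

/-- The invertible submatrix `A_I`. -/
def subMat (I : LPBasis A) : Matrix (Fin m) (Fin m) ℝ := A.submatrix id I.emb

/-- The primal basic solution `x(I, v) = Aug_I (A_I⁻¹ v)`, with zeros outside `I`. -/
def primalSol (I : LPBasis A) (v : Fin m → ℝ) : Fin d → ℝ :=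
  Function.extend I.emb (I.subMat⁻¹ *ᵥ v) 0

/-- The dual basic solution `λ(I) = A_I⁻ᵀ c_I`. -/
def dualSol (I : LPBasis A) (c : Fin d → ℝ) : Fin m → ℝ :=
  (I.subMat⁻¹)ᵀ *ᵥ (c ∘ I.emb)

/-- `I` is a dual feasible basis: `Aᵀ λ(I) ≤ c`. -/
def DualFeasible (I : LPBasis A) (c : Fin d → ℝ) : Prop := Aᵀ *ᵥ I.dualSol c ≤ c

/-- `I` is a primal feasible basis for the right-hand side `v`: `x(I, v) ≥ 0`. -/
def PrimalFeasible (I : LPBasis A) (v : Fin m → ℝ) : Prop := 0 ≤ I.primalSol v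

end LPBasis

section Deterministic

variable {m d : ℕ} (A : Matrix (Fin m) (Fin d) ℝ) (c : Fin d → ℝ) (b : Fin m → ℝ)

open Classical in
/-- The bases `I_1, ..., I_K` that are both dual feasible and primal feasible for `b`. -/
def optBases : Finset (LPBasis A) :=
  Finset.univ.filter fun I => I.DualFeasible c ∧ I.PrimalFeasible b

/-- The non-empty subsets `𝒦` of `{I_1, ..., I_K}`. -/
def basisSubsets : Finset (Finset (LPBasis A)) :=
  (optBases A c b).powerset.filter fun 𝒦 => 𝒦.Nonempty

/-- The dual optimal basic solutions `λ(I_1), ..., λ(I_K)` are pairwise distinct. -/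
def AssumptionA3 : Prop :=
  ∀ I ∈ optBases A c b, ∀ J ∈ optBases A c b, I ≠ J → I.dualSol c ≠ J.dualSol c

end Deterministic

/-- The positive entries of `x`. -/
def posSet {d : ℕ} (x : Fin d → ℝ) : Set (Fin d) := {i | 0 < x i}

section Support

variable {m d : ℕ} (A : Matrix (Fin m) (Fin d) ℝ) (c : Fin d → ℝ) (b : Fin m → ℝ)
  (x : Fin d → ℝ)

/-- The union of all dual feasible bases `I` that induce `x`, i.e. `x = x(I, b)`. -/
def inducingUnion : Set (Fin d) :=
  {i | ∃ I : LPBasis A, I.DualFeasible c ∧ x = I.primalSol b ∧ i ∈ I.idx}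

/-- The true zeros of `x`. -/
def trueZeros : Set (Fin d) := (inducingUnion A c b x)ᶜ

/-- The degenerate zeros of `x`. -/
def degZeros : Set (Fin d) := inducingUnion A c b x \ posSet x

/-- The closed convex cone `H_I` of all `v` such that `(A_I⁻¹ v)_j ≥ 0` for every `j` with
`i_j ∉ Pos(x)`. -/
def cone {A : Matrix (Fin m) (Fin d) ℝ} (x : Fin d → ℝ) (I : LPBasis A) : Set (Fin m → ℝ) :=
  {v | ∀ j, I.emb j ∉ posSet x → 0 ≤ (I.subMat⁻¹ *ᵥ v) j}

/-- The region `(⋂_{k ∈ 𝒦} H_k) \ ⋃_{k ≤ K, k ∉ 𝒦} H_k`. -/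
def region (𝒦 : Finset (LPBasis A)) : Set (Fin m → ℝ) :=
  (⋂ I ∈ 𝒦, cone x I) \ ⋃ I ∈ {J | J ∈ optBases A c b ∧ J ∉ 𝒦}, cone x I

/-- `α ⊗ x(I_𝒦, v) = ∑_{k ∈ 𝒦} α_k x(I_k, v)`. -/
def mix {A : Matrix (Fin m) (Fin d) ℝ} (𝒦 : Finset (LPBasis A)) (α : 𝒦 → ℝ)
    (v : Fin m → ℝ) : Fin d → ℝ :=
  ∑ I : 𝒦, α I • I.1.primalSol v

open Classical in
/-- The limit `M(v) = ∑_𝒦 1{v ∈ H_𝒦 \ ⋃_{k ∉ 𝒦} H_k} α^𝒦 ⊗ x(I_𝒦, v)`, the sum being over the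
non-empty subsets `𝒦` of `{I_1, ..., I_K}`. -/
def limitMap (α : ∀ 𝒦 : Finset (LPBasis A), 𝒦 → ℝ) (v : Fin m → ℝ) : Fin d → ℝ :=
  ∑ 𝒦 ∈ basisSubsets A c b, if v ∈ region A c b x 𝒦 then mix 𝒦 (α 𝒦) v else 0

end Support

section Stochastic

variable {m d : ℕ} {Ω Ω' : Type*} [MeasurableSpace Ω] [MeasurableSpace Ω']

/-- The random vectors `b_n` differ from `b` in the first `m₀` coordinates only, and
`r_n (b_n - b)` converges in distribution to `G = (G^{m₀}, 0)` where `r_n → ∞` and the law of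
`G^{m₀}` is absolutely continuous with respect to Lebesgue measure on `ℝ^{m₀}`. -/
structure AssumptionB1 (b : Fin m → ℝ) (m₀ : ℕ) (hm₀ : m₀ ≤ m) (r : ℕ → ℝ)
    (bn : ℕ → Ω → Fin m → ℝ) (G : Ω' → Fin m → ℝ)
    (P : Measure Ω) [IsProbabilityMeasure P] (P' : Measure Ω') [IsProbabilityMeasure P'] :
    Prop where
  rate : Tendsto r atTop atTop
  measurable_bn : ∀ n, Measurable (bn n)
  measurable_G : Measurable G
  bn_eq : ∀ n ω, ∀ i : Fin m, m₀ ≤ (i : ℕ) → bn n ω i = b i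
  G_eq : ∀ ω, ∀ i : Fin m, m₀ ≤ (i : ℕ) → G ω i = 0
  tendsto : TendstoInDistribution (fun n ω => r n • (bn n ω - b)) atTop G (fun _ => P) P'
  abs_cont : P'.map (fun ω (i : Fin m₀) => G ω (Fin.castLE hm₀ i)) ≪ volume

/-- An optimal solution of the program with right-hand side `b_n` exists with probability tending
to one. -/
def AssumptionB2 (A : Matrix (Fin m) (Fin d) ℝ) (c : Fin d → ℝ) (bn : ℕ → Ω → Fin m → ℝ)
    (P : Measure Ω) : Prop :=
  Tendsto (fun n => P {ω | (optSet A c (bn n ω)).Nonempty}) atTop (𝓝 1)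

/-- `x^⋆(b_n)`: a measurable choice of an optimal solution of the program with right-hand side
`b_n`, on the event that one exists. -/
structure IsEmpiricalSolution (A : Matrix (Fin m) (Fin d) ℝ) (c : Fin d → ℝ)
    (bn : ℕ → Ω → Fin m → ℝ) (xn : ℕ → Ω → Fin d → ℝ) : Prop where
  measurable : ∀ n, Measurable (xn n)
  mem_optSet : ∀ n ω, (optSet A c (bn n ω)).Nonempty → xn n ω ∈ optSet A c (bn n ω)

/-- The event `A_n^𝒦`, for a random right-hand side `β = b_n`, that the dual feasible bases that
are primal feasible for `β` are exactly those in `𝒦`. -/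
def basisEvent (A : Matrix (Fin m) (Fin d) ℝ) (c : Fin d → ℝ) (β : Ω → Fin m → ℝ)
    (𝒦 : Finset (LPBasis A)) : Set Ω :=
  {ω | ∀ I : LPBasis A, I.DualFeasible c → (I.PrimalFeasible (β ω) ↔ I ∈ 𝒦)}

/-- The random weights `α_n^𝒦` of the empirical solutions, and their limits `α^𝒦`: for every
non-empty `𝒦 ⊆ {I_1, ..., I_K}`, the vector `α_n^𝒦` lies in the unit simplex, one has
`x^⋆(b_n) = α_n^𝒦 ⊗ x(I_𝒦, b_n)` on `A_n^𝒦`, and `(α_n^𝒦, r_n (b_n - b))` converges jointly in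
distribution to `(α^𝒦, G)`. -/
structure IsWeightLimit (A : Matrix (Fin m) (Fin d) ℝ) (c : Fin d → ℝ) (b : Fin m → ℝ)
    (r : ℕ → ℝ) (bn : ℕ → Ω → Fin m → ℝ) (xn : ℕ → Ω → Fin d → ℝ)
    (G : Ω' → Fin m → ℝ)
    (αn : ℕ → ∀ 𝒦 : Finset (LPBasis A), Ω → 𝒦 → ℝ)
    (α : ∀ 𝒦 : Finset (LPBasis A), Ω' → 𝒦 → ℝ)
    (P : Measure Ω) [IsProbabilityMeasure P] (P' : Measure Ω') [IsProbabilityMeasure P'] :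
    Prop where
  measurable_weights : ∀ n, ∀ 𝒦 ∈ basisSubsets A c b, Measurable (αn n 𝒦)
  measurable_limit : ∀ 𝒦 ∈ basisSubsets A c b, Measurable (α 𝒦)
  weights_mem : ∀ n, ∀ 𝒦 ∈ basisSubsets A c b, ∀ ω, αn n 𝒦 ω ∈ stdSimplex ℝ 𝒦
  limit_mem : ∀ 𝒦 ∈ basisSubsets A c b, ∀ ω, α 𝒦 ω ∈ stdSimplex ℝ 𝒦
  repr : ∀ n, ∀ 𝒦 ∈ basisSubsets A c b, ∀ ω ∈ basisEvent A c (bn n) 𝒦,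
    xn n ω = mix 𝒦 (αn n 𝒦 ω) (bn n ω)
  tendsto : ∀ 𝒦 ∈ basisSubsets A c b,
    TendstoInDistribution (fun n ω => (αn n 𝒦 ω, r n • (bn n ω - b))) atTop
      (fun ω => (α 𝒦 ω, G ω)) (fun _ => P) P'

/-- The face of the unit simplex `Δ_𝒦` spanned by the vertices in `S`. -/
def simplexFace {ι : Type*} [Fintype ι] (S : Set ι) : Set (ι → ℝ) :=
  {a | a ∈ stdSimplex ℝ ι ∧ ∀ k, k ∉ S → a k = 0}

/-- The limiting weights `α^𝒦` are not concentrated on a lower-dimensional face of the simplex.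
Since the weights `α^𝒦` only have a meaning on the event that `G` lies in the region belonging to
`𝒦`, this refers to the conditional law of `α^𝒦` given that event, for all `𝒦` for which the event
has positive probability. -/
def WeightsNotConcentrated (A : Matrix (Fin m) (Fin d) ℝ) (c : Fin d → ℝ) (b : Fin m → ℝ)
    (x : Fin d → ℝ) (G : Ω' → Fin m → ℝ)
    (α : ∀ 𝒦 : Finset (LPBasis A), Ω' → 𝒦 → ℝ) (P' : Measure Ω') : Prop :=
  ∀ 𝒦 ∈ basisSubsets A c b, P' {ω | G ω ∈ region A c b x 𝒦} ≠ 0 →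
    ∀ S : Set 𝒦, S ≠ Set.univ →
      ¬ ∀ᵐ ω ∂(P'[|{ω | G ω ∈ region A c b x 𝒦}]), α 𝒦 ω ∈ simplexFace S

/-- The density of the law of `G` with respect to Lebesgue measure is (almost everywhere) positive
in a neighborhood of the origin. -/
def DensityPosNearZero (G : Ω' → Fin m → ℝ) (P' : Measure Ω') : Prop :=
  ∃ U ∈ 𝓝 (0 : Fin m → ℝ), ∀ᵐ v ∂(volume : Measure (Fin m → ℝ)),
    v ∈ U → 0 < (P'.map G).rnDeriv volume v

end Stochastic

end

end StochLP

/-! Part 1 is a deterministic statement about right-hand sides `v` near `b`, combined with `b_n → b`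
in probability. Near `b`, a dual feasible basis that is primal feasible for `v` is already primal
feasible for `b` (`eventually_mem_optBases`), so it induces `x`. An arbitrary optimal `y` for `v`
need not be basic, but its support can be shrunk to that of a basic optimal solution while keeping a
prescribed positive coordinate (`exists_dualFeasible_posSet`); uniqueness of `x` excludes the
recession directions that would block this. Keeping coordinate `i` shows that `i` is not a true
zero, and the inclusion of supports gives positivity on `Pos(x)`.

For part 2, a degenerate zero `i` lies in some optimal basis `I`. The cone of `I` has interior
points arbitrarily close to the origin, so some region with `I ∈ 𝒦` has positive probability. There
all summands of the `i`-th coordinate of the limit are non-negative and `x(I, G)_i ≠ 0` almost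
surely. If that coordinate were almost surely not positive, the weight of `I` would vanish on the
region, placing the weights on the face opposite to the vertex `I`, against (NC).

If the dual solutions are distinct, two cones meet only inside a hyperplane
(`dualSol_dotProduct_eq`). Regions of positive probability then belong to singletons, whose simplex
has only the empty proper face. -/

namespace StochLP

/-! ### Farkas' lemma and feasible directions -/

/-- **Farkas' lemma** for finitely many linear functionals. -/
theorem farkas {V ι : Type*} [AddCommGroup V] [Module ℝ V] (s : Finset ι) :
    ∀ (a : ι → V →ₗ[ℝ] ℝ) (f : V →ₗ[ℝ] ℝ),
      (∀ w, (∀ j ∈ s, 0 ≤ a j w) → 0 ≤ f w) →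
      ∃ y : ι → ℝ, (∀ j, 0 ≤ y j) ∧ ∀ w, f w = ∑ j ∈ s, y j * a j w := by
  classical
  induction s using Finset.induction_on with
  | empty =>
    intro a f h
    refine ⟨0, fun _ => le_rfl, fun w => ?_⟩
    have h1 := h w (by simp)
    have h2 := h (-w) (by simp)
    rw [map_neg] at h2
    simp only [Finset.sum_empty]
    linarith
  | insert n s hn ih =>
    intro a f h
    by_cases hs : ∀ w, (∀ j ∈ s, 0 ≤ a j w) → 0 ≤ f w
    · obtain ⟨y, hy, hf⟩ := ih a f hs
      refine ⟨Function.update y n 0, fun j => ?_, fun w => ?_⟩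
      · by_cases hj : j = n
        · simp [hj]
        · simpa [hj] using hy j
      · rw [Finset.sum_insert hn, hf]
        simp only [Function.update_self, zero_mul, zero_add]
        refine Finset.sum_congr rfl fun j hj => ?_
        rw [Function.update_of_ne (ne_of_mem_of_not_mem hj hn)]
    · push Not at hs
      obtain ⟨u, hu, hfu⟩ := hs
      have hau : a n u < 0 := by
        by_contra hcon
        push Not at hcon
        exact absurd (h u fun j hj => by
          rcases Finset.mem_insert.1 hj with rfl | hj
          exacts [hcon, hu j hj]) (not_le.2 hfu)
      set k : ℝ := (-(a n u))⁻¹ with hk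
      have hkpos : 0 < k := inv_pos.2 (by linarith)
      have hka : k * a n u = -1 := by
        rw [hk, inv_neg, neg_mul, inv_mul_cancel₀ hau.ne]
      -- These are the functionals composed with `w ↦ w + (k * a n w) • u`, the projection along `u`
      -- onto the kernel of `a n`; the constraint `n` becomes vacuous.
      obtain ⟨y, hy, hf⟩ := ih (fun j => a j + (k * a j u) • a n) (f + (k * f u) • a n)
        (fun w hw => by
          have := h (w + (k * a n w) • u) (fun j hj => by
            rcases Finset.mem_insert.1 hj with rfl | hj
            · simp only [map_add, map_smul, smul_eq_mul]
              exact le_of_eq (by linear_combination (-(a j w)) * hka)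
            · have := hw j hj
              simp only [LinearMap.add_apply, LinearMap.smul_apply, smul_eq_mul] at this
              simp only [map_add, map_smul, smul_eq_mul]
              linarith)
          simp only [map_add, map_smul, smul_eq_mul] at this
          simp only [LinearMap.add_apply, LinearMap.smul_apply, smul_eq_mul]
          linarith)
      -- The new coefficient collects the multiples of `a n`; it is non-negative because `f u < 0 ≤
      -- a j u`.
      refine ⟨Function.update y n (k * (∑ j ∈ s, y j * a j u - f u)), fun j => ?_, fun w => ?_⟩
      · by_cases hj : j = n
        · subst hj
          simp only [Function.update_self]
          refine mul_nonneg hkpos.le ?_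
          have := Finset.sum_nonneg fun j hj => mul_nonneg (hy j) (hu j hj)
          linarith
        · simpa [hj] using hy j
      · have := hf w
        simp only [LinearMap.add_apply, LinearMap.smul_apply, smul_eq_mul] at this
        rw [Finset.sum_insert hn, Function.update_self]
        have h2 : ∑ j ∈ s, Function.update y n (k * (∑ j ∈ s, y j * a j u - f u)) j * a j w
            = ∑ j ∈ s, y j * a j w :=
          Finset.sum_congr rfl fun j hj => by
            rw [Function.update_of_ne (ne_of_mem_of_not_mem hj hn)]
        rw [h2]
        have h3 : ∑ j ∈ s, y j * (a j w + k * a j u * a n w)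
            = ∑ j ∈ s, y j * a j w + k * a n w * ∑ j ∈ s, y j * a j u := by
          rw [Finset.mul_sum, ← Finset.sum_add_distrib]
          exact Finset.sum_congr rfl fun j _ => by ring
        rw [h3] at this
        linear_combination this

/-- A non-negative vector can be moved a little in every direction that does not decrease its zero
entries. -/
theorem exists_pos_add_smul_nonneg {d : ℕ} {y w : Fin d → ℝ} (hy : 0 ≤ y)
    (hw : ∀ j, y j = 0 → 0 ≤ w j) : ∃ t : ℝ, 0 < t ∧ 0 ≤ y + t • w := by
  have key : ∀ j, ∀ᶠ t : ℝ in 𝓝[>] 0, 0 ≤ y j + t * w j := fun j => by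
    rcases (hy j).eq_or_lt with h | h
    · filter_upwards [self_mem_nhdsWithin] with t ht
      have := mul_nonneg (le_of_lt ht) (hw j h.symm)
      simp only [Pi.zero_apply] at h
      linarith
    · have : Tendsto (fun t : ℝ => y j + t * w j) (𝓝[>] 0) (𝓝 (y j)) := by
        have : Continuous fun t : ℝ => y j + t * w j := by fun_prop
        simpa using (this.tendsto 0).mono_left nhdsWithin_le_nhds
      exact (this.eventually (lt_mem_nhds h)).mono fun t ht => le_of_lt ht
  obtain ⟨t, ht, ht0⟩ := ((eventually_all.2 key).and self_mem_nhdsWithin).exists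
  exact ⟨t, ht0, fun j => ht j⟩

/-! ### Linear programming duality -/

section Deterministic

variable {m d : ℕ} {A : Matrix (Fin m) (Fin d) ℝ} {c : Fin d → ℝ} {v : Fin m → ℝ}

theorem dotProduct_nonneg_of_mem_optSet {y w : Fin d → ℝ} (hy : y ∈ optSet A c v)
    (hAw : A *ᵥ w = 0) (hw : ∀ j, y j = 0 → 0 ≤ w j) : 0 ≤ c ⬝ᵥ w := by
  obtain ⟨t, ht, hyt⟩ := exists_pos_add_smul_nonneg hy.1.2 hw
  have := hy.2 (y + t • w) ⟨by rw [mulVec_add, mulVec_smul, hAw, smul_zero, add_zero, hy.1.1], hyt⟩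
  rw [dotProduct_add, dotProduct_smul, smul_eq_mul] at this
  exact nonneg_of_mul_nonneg_right (by linarith) ht

theorem transpose_mulVec_apply (A : Matrix (Fin m) (Fin d) ℝ) (l : Fin m → ℝ) (j : Fin d) :
    (Aᵀ *ᵥ l) j = l ⬝ᵥ A.col j := by
  rw [dotProduct_comm]; rfl

/-- Strong duality in the form of complementary slackness. -/
theorem exists_dual_of_mem_optSet {y : Fin d → ℝ} (hy : y ∈ optSet A c v) :
    ∃ l : Fin m → ℝ, Aᵀ *ᵥ l ≤ c ∧ ∀ j, 0 < y j → (Aᵀ *ᵥ l) j = c j := by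
  classical
  let N := LinearMap.ker A.mulVecLin
  let s : Finset (Fin d) := Finset.univ.filter fun j => y j = 0
  obtain ⟨u, hu, hc⟩ := farkas (V := N) s (fun j => (LinearMap.proj j).comp N.subtype)
    ((dotProductEquiv ℝ (Fin d) c).comp N.subtype) (fun w hw => by
      have hAw : A *ᵥ (w : Fin d → ℝ) = 0 := LinearMap.mem_ker.1 w.2
      exact dotProduct_nonneg_of_mem_optSet hy hAw fun j hj => hw j (by simp [s, hj]))
  -- The Farkas multipliers serve as reduced costs: `c - z` annihilates the kernel of `A`, so it has
  -- the form `Aᵀ l`.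
  let z : Fin d → ℝ := fun j => if y j = 0 then u j else 0
  have hz : dotProductEquiv ℝ (Fin d) (c - z) ∈ N.dualAnnihilator := by
    rw [Submodule.mem_dualAnnihilator]
    intro w hw
    have := hc ⟨w, hw⟩
    simp only [LinearMap.comp_apply, Submodule.subtype_apply, dotProductEquiv_apply_apply,
      LinearMap.proj_apply] at this
    rw [dotProductEquiv_apply_apply, sub_dotProduct, this, sub_eq_zero, Finset.sum_filter]
    simp [dotProduct, z]
  rw [← LinearMap.range_dualMap_eq_dualAnnihilator_ker] at hz
  obtain ⟨g, hg⟩ := hz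
  obtain ⟨l, rfl⟩ := (dotProductEquiv ℝ (Fin m)).surjective g
  have key : ∀ j, (Aᵀ *ᵥ l) j = c j - z j := fun j => by
    have := LinearMap.congr_fun hg (Pi.single j 1)
    simp only [LinearMap.dualMap_apply, dotProductEquiv_apply_apply, mulVecLin_apply,
      mulVec_single_one, dotProduct_single_one] at this
    rw [transpose_mulVec_apply, this, Pi.sub_apply]
  refine ⟨l, fun j => ?_, fun j hj => ?_⟩
  · rw [key]
    have : 0 ≤ z j := by
      dsimp only [z]; split_ifs
      exacts [hu j, le_rfl]
    linarith
  · rw [key]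
    simp [z, hj.ne']

theorem span_range_col_eq_top (hA : A.rank = m) : Submodule.span ℝ (Set.range A.col) = ⊤ := by
  apply Submodule.eq_top_of_finrank_eq
  rw [← Matrix.rank_eq_finrank_span_cols, hA, Module.finrank_fin_fun]

/-- A dual feasible point can be moved to one whose tight columns span the whole space. -/
theorem exists_dual_span_tight (hA : A.rank = m) {l₀ : Fin m → ℝ} (hl₀ : Aᵀ *ᵥ l₀ ≤ c) :
    ∃ l : Fin m → ℝ, Aᵀ *ᵥ l ≤ c ∧ (∀ j, (Aᵀ *ᵥ l₀) j = c j → (Aᵀ *ᵥ l) j = c j) ∧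
      Submodule.span ℝ (A.col '' {j | (Aᵀ *ᵥ l) j = c j}) = ⊤ := by
  classical
  let S : Set (Fin m → ℝ) :=
    {l | Aᵀ *ᵥ l ≤ c ∧ ∀ j, (Aᵀ *ᵥ l₀) j = c j → (Aᵀ *ᵥ l) j = c j}
  let tight : (Fin m → ℝ) → Set (Fin d) := fun l => {j | (Aᵀ *ᵥ l) j = c j}
  -- A maximal tight set must span: otherwise a direction orthogonal to the tight columns leads to
  -- one more tight constraint.
  obtain ⟨l, hlS, hmax⟩ := Set.Finite.exists_maximalFor' tight S (Set.toFinite _)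
    ⟨l₀, hl₀, fun _ => id⟩
  refine ⟨l, hlS.1, hlS.2, ?_⟩
  by_contra hspan
  obtain ⟨g, hg0, hg⟩ := Submodule.exists_le_ker_of_lt_top _ (lt_top_iff_ne_top.2 hspan)
  have hne : ∃ j, g (A.col j) ≠ 0 := by
    by_contra hcon
    push Not at hcon
    apply hg0
    have hle : Submodule.span ℝ (Set.range A.col) ≤ LinearMap.ker g := by
      rw [Submodule.span_le]
      rintro _ ⟨j, rfl⟩
      exact hcon j
    rw [span_range_col_eq_top hA, top_le_iff] at hle
    exact LinearMap.ker_eq_top.1 hle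
  obtain ⟨u, hu, j₁, hj₁⟩ : ∃ u : Fin m → ℝ, (∀ j ∈ tight l, (Aᵀ *ᵥ u) j = 0) ∧
      ∃ j, 0 < (Aᵀ *ᵥ u) j := by
    obtain ⟨u, rfl⟩ := (dotProductEquiv ℝ (Fin m)).surjective g
    have hu : ∀ j ∈ tight l, (Aᵀ *ᵥ u) j = 0 := fun j hj => by
      rw [transpose_mulVec_apply]
      exact hg (Submodule.subset_span ⟨j, hj, rfl⟩)
    obtain ⟨j, hj⟩ := hne
    rw [dotProductEquiv_apply_apply, ← transpose_mulVec_apply] at hj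
    rcases hj.lt_or_gt with h | h
    · refine ⟨-u, fun k hk => ?_, j, ?_⟩
      · rw [mulVec_neg, Pi.neg_apply, hu k hk, neg_zero]
      · rw [mulVec_neg, Pi.neg_apply]; linarith
    · exact ⟨u, hu, j, h⟩
  -- Ratio test: the minimal ratio is the longest step along `u` preserving dual feasibility, and
  -- its minimizer becomes tight.
  let F : Finset (Fin d) := Finset.univ.filter fun j => 0 < (Aᵀ *ᵥ u) j
  obtain ⟨j₀, hj₀, hmin⟩ := Finset.exists_min_image F
    (fun j => (c j - (Aᵀ *ᵥ l) j) / (Aᵀ *ᵥ u) j) ⟨j₁, by simp [F, hj₁]⟩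
  have hj₀' : 0 < (Aᵀ *ᵥ u) j₀ := by simpa [F] using hj₀
  set t := (c j₀ - (Aᵀ *ᵥ l) j₀) / (Aᵀ *ᵥ u) j₀ with ht
  have ht0 : 0 ≤ t := div_nonneg (sub_nonneg.2 (hlS.1 j₀)) hj₀'.le
  have hval : ∀ j, (Aᵀ *ᵥ (l + t • u)) j = (Aᵀ *ᵥ l) j + t * (Aᵀ *ᵥ u) j := fun j => by
    rw [mulVec_add, mulVec_smul]; rfl
  have htight : ∀ j ∈ tight l, j ∈ tight (l + t • u) := fun j hj => by
    change (Aᵀ *ᵥ (l + t • u)) j = c j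
    rw [hval, hu j hj, mul_zero, add_zero]; exact hj
  have hmem : l + t • u ∈ S := by
    refine ⟨fun j => ?_, fun j hj => htight j (hlS.2 j hj)⟩
    rw [hval]
    have h1 := hlS.1 j
    by_cases hj : 0 < (Aᵀ *ᵥ u) j
    · have := hmin j (by simp [F, hj])
      rw [le_div_iff₀ hj] at this
      linarith
    · have := mul_nonneg ht0 (neg_nonneg.2 (not_lt.1 hj))
      linarith
  have hj₀t : j₀ ∈ tight (l + t • u) := by
    change (Aᵀ *ᵥ (l + t • u)) j₀ = c j₀
    rw [hval, ht, div_mul_cancel₀ _ hj₀'.ne']; ring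
  exact hj₀'.ne' (hu j₀ (hmax hmem htight hj₀t))

/-! ### Basic primal and dual solutions -/

namespace LPBasis

theorem range_emb (I : LPBasis A) : Set.range I.emb = I.idx :=
  Finset.range_orderEmbOfFin _ _

theorem isUnit_det_subMat (I : LPBasis A) : IsUnit I.subMat.det := I.isUnit_det

theorem primalSol_emb (I : LPBasis A) (v : Fin m → ℝ) (k : Fin m) :
    I.primalSol v (I.emb k) = (I.subMat⁻¹ *ᵥ v) k :=
  I.emb.injective.extend_apply _ _ _

theorem primalSol_of_notMem (I : LPBasis A) (v : Fin m → ℝ) {i : Fin d} (hi : i ∉ I.idx) :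
    I.primalSol v i = 0 := by
  rw [← Finset.mem_coe, ← I.range_emb] at hi
  exact Function.extend_apply' _ _ _ hi

theorem dotProduct_of_support (I : LPBasis A) (u : Fin d → ℝ) {y : Fin d → ℝ}
    (hy : ∀ i ∉ I.idx, y i = 0) : u ⬝ᵥ y = (u ∘ I.emb) ⬝ᵥ (y ∘ I.emb) := by
  refine (Fintype.sum_of_injective I.emb I.emb.injective _ _ (fun i hi => ?_) fun _ => rfl).symm
  rw [I.range_emb] at hi
  rw [hy i hi, mul_zero]

theorem mulVec_of_support (I : LPBasis A) {y : Fin d → ℝ} (hy : ∀ i ∉ I.idx, y i = 0) :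
    A *ᵥ y = I.subMat *ᵥ (y ∘ I.emb) :=
  funext fun i => I.dotProduct_of_support (A i) hy

theorem primalSol_comp_emb (I : LPBasis A) (v : Fin m → ℝ) :
    I.primalSol v ∘ I.emb = I.subMat⁻¹ *ᵥ v :=
  funext fun k => I.primalSol_emb v k

theorem mulVec_primalSol (I : LPBasis A) (v : Fin m → ℝ) : A *ᵥ I.primalSol v = v := by
  rw [I.mulVec_of_support fun i hi => I.primalSol_of_notMem v hi, primalSol_comp_emb,
    mulVec_mulVec, mul_nonsing_inv _ I.isUnit_det_subMat, one_mulVec]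

theorem eq_primalSol (I : LPBasis A) {y : Fin d → ℝ} (hy : ∀ i ∉ I.idx, y i = 0)
    (hAy : A *ᵥ y = v) : y = I.primalSol v := by
  have h : y ∘ I.emb = I.subMat⁻¹ *ᵥ v := by
    rw [← hAy, I.mulVec_of_support hy, mulVec_mulVec, nonsing_inv_mul _ I.isUnit_det_subMat,
      one_mulVec]
  funext i
  by_cases hi : i ∈ I.idx
  · rw [← Finset.mem_coe, ← I.range_emb] at hi
    obtain ⟨k, rfl⟩ := hi
    rw [primalSol_emb, ← h]; rfl
  · rw [hy i hi, I.primalSol_of_notMem v hi]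

theorem transpose_subMat_mulVec (I : LPBasis A) (l : Fin m → ℝ) :
    I.subMatᵀ *ᵥ l = (Aᵀ *ᵥ l) ∘ I.emb := rfl

theorem transpose_mulVec_dualSol (I : LPBasis A) (c : Fin d → ℝ) :
    (Aᵀ *ᵥ I.dualSol c) ∘ I.emb = c ∘ I.emb := by
  rw [← transpose_subMat_mulVec, dualSol, mulVec_mulVec, ← transpose_mul,
    nonsing_inv_mul _ I.isUnit_det_subMat, transpose_one, one_mulVec]

/-- Transfers dual feasibility from a point `l` to any basis chosen among its tight columns. -/
theorem dualSol_eq (I : LPBasis A) {l : Fin m → ℝ} (hl : ∀ i ∈ I.idx, (Aᵀ *ᵥ l) i = c i) :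
    I.dualSol c = l := by
  have h : c ∘ I.emb = I.subMatᵀ *ᵥ l := by
    rw [transpose_subMat_mulVec]
    funext k
    refine (hl _ ?_).symm
    rw [← Finset.mem_coe, ← I.range_emb]
    exact ⟨k, rfl⟩
  rw [dualSol, h, mulVec_mulVec, ← transpose_mul, mul_nonsing_inv _ I.isUnit_det_subMat,
    transpose_one, one_mulVec]

theorem dotProduct_primalSol (I : LPBasis A) (c : Fin d → ℝ) (v : Fin m → ℝ) :
    c ⬝ᵥ I.primalSol v = I.dualSol c ⬝ᵥ v := by
  have h0 := fun i (hi : i ∉ I.idx) => I.primalSol_of_notMem v hi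
  rw [I.dotProduct_of_support c h0, ← transpose_mulVec_dualSol,
    ← I.dotProduct_of_support (Aᵀ *ᵥ I.dualSol c) h0, mulVec_transpose, ← dotProduct_mulVec,
    mulVec_primalSol]

/-- Weak duality. -/
theorem DualFeasible.dualSol_dotProduct_le {I : LPBasis A} (hI : I.DualFeasible c)
    {y : Fin d → ℝ} (hy : y ∈ feasibleSet A v) : I.dualSol c ⬝ᵥ v ≤ c ⬝ᵥ y := by
  rw [← hy.1, dotProduct_mulVec, ← mulVec_transpose]
  exact dotProduct_le_dotProduct_of_nonneg_right hI hy.2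

theorem DualFeasible.primalSol_mem_optSet {I : LPBasis A} (hI : I.DualFeasible c)
    (hv : I.PrimalFeasible v) : I.primalSol v ∈ optSet A c v :=
  ⟨⟨I.mulVec_primalSol v, hv⟩, fun y hy => by
    rw [dotProduct_primalSol]
    exact hI.dualSol_dotProduct_le hy⟩

theorem primalSol_add (I : LPBasis A) (u v : Fin m → ℝ) :
    I.primalSol (u + v) = I.primalSol u + I.primalSol v := by
  refine (I.eq_primalSol (fun i hi => ?_) ?_).symm
  · simp [I.primalSol_of_notMem _ hi]
  · simp [mulVec_add, mulVec_primalSol]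

theorem primalSol_smul (I : LPBasis A) (t : ℝ) (v : Fin m → ℝ) :
    I.primalSol (t • v) = t • I.primalSol v := by
  refine (I.eq_primalSol (fun i hi => ?_) ?_).symm
  · simp [I.primalSol_of_notMem _ hi]
  · simp [mulVec_smul, mulVec_primalSol]

/-- `v ↦ x(I, v)_i` as a linear functional. -/
noncomputable def primalCoord (I : LPBasis A) (i : Fin d) : (Fin m → ℝ) →ₗ[ℝ] ℝ where
  toFun v := I.primalSol v i
  map_add' u v := by rw [primalSol_add]; rfl
  map_smul' t v := by rw [primalSol_smul]; rfl

theorem primalCoord_apply (I : LPBasis A) (i : Fin d) (v : Fin m → ℝ) :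
    I.primalCoord i v = I.primalSol v i := rfl

theorem continuous_primalSol_apply (I : LPBasis A) (i : Fin d) :
    Continuous fun v => I.primalSol v i :=
  (I.primalCoord i).continuous_of_finiteDimensional

theorem continuous_primalSol (I : LPBasis A) : Continuous I.primalSol :=
  continuous_pi fun i => I.continuous_primalSol_apply i

end LPBasis

/-! ### Reduction of optimal solutions to basic ones -/

/-- A linearly independent set of columns inside a spanning one can be completed to a basis. -/
theorem exists_basis_between {S T : Set (Fin d)} (hST : S ⊆ T) (hS : LinearIndepOn ℝ A.col S)
    (hT : Submodule.span ℝ (A.col '' T) = ⊤) :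
    ∃ I : LPBasis A, S ⊆ I.idx ∧ (I.idx : Set (Fin d)) ⊆ T := by
  classical
  obtain ⟨B, hBT, hSB, hsp, hB⟩ := exists_linearIndepOn_extension hS hST
  have hspan : Submodule.span ℝ (A.col '' B) = ⊤ := by
    rw [eq_top_iff, ← hT]
    exact Submodule.span_le.2 hsp
  have hcard : B.toFinset.card = m := by
    have h1 := finrank_span_eq_card (R := ℝ) (b := fun i : B => A.col i) hB
    rw [← Set.image_eq_range, hspan, finrank_top, Module.finrank_fin_fun] at h1
    rw [Set.toFinset_card, ← h1]
  refine ⟨⟨B.toFinset, hcard, ?_⟩, by simpa using hSB, by simpa using hBT⟩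
  rw [← isUnit_iff_isUnit_det, ← linearIndependent_cols_iff_isUnit]
  refine LinearIndependent.comp (v := fun i : B => A.col i) hB
    (fun k => ⟨B.toFinset.orderEmbOfFin hcard k, ?_⟩) fun a b hab => ?_
  · exact Set.mem_toFinset.1 (Finset.orderEmbOfFin_mem B.toFinset hcard k)
  · simpa using hab

/-- An optimal solution with linearly independent support is a basic solution belonging to a dual
feasible basis. -/
theorem exists_dualFeasible_of_linearIndepOn (hA : A.rank = m) {y : Fin d → ℝ}
    (hy : y ∈ optSet A c v) (hind : LinearIndepOn ℝ A.col (posSet y)) :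
    ∃ I : LPBasis A, I.DualFeasible c ∧ I.PrimalFeasible v ∧ y = I.primalSol v ∧
      posSet y ⊆ I.idx := by
  obtain ⟨l₀, hl₀, hcs⟩ := exists_dual_of_mem_optSet hy
  obtain ⟨l, hl, hll, hspan⟩ := exists_dual_span_tight hA hl₀
  obtain ⟨I, hSI, hIT⟩ := exists_basis_between (S := posSet y) (fun j hj => hll j (hcs j hj))
    hind hspan
  have hyI : y = I.primalSol v := I.eq_primalSol (fun i hi => by
    by_contra hne
    exact hi (hSI (lt_of_le_of_ne (hy.1.2 i) (Ne.symm hne)))) hy.1.1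
  refine ⟨I, ?_, ?_, hyI, hSI⟩
  · rw [LPBasis.DualFeasible, I.dualSol_eq (l := l) fun i hi => hIT hi]
    exact hl
  · rw [LPBasis.PrimalFeasible, ← hyI]
    exact hy.1.2

/-- Otherwise `x + w` would be a second optimum for `b`. The conditions on `w` do not involve the
right-hand side, so the conclusion serves every `v`. -/
theorem eq_zero_of_ray {b : Fin m → ℝ} {x : Fin d → ℝ} (hx : optSet A c b = {x})
    {w : Fin d → ℝ} (hw : 0 ≤ w) (hAw : A *ᵥ w = 0) (hcw : c ⬝ᵥ w = 0) : w = 0 := by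
  have hxo : x ∈ optSet A c b := by rw [hx]; rfl
  have : x + w ∈ optSet A c b := by
    refine ⟨⟨by rw [mulVec_add, hAw, add_zero, hxo.1.1], add_nonneg hxo.1.2 hw⟩, fun y hy => ?_⟩
    rw [dotProduct_add, hcw, add_zero]
    exact hxo.2 y hy
  rw [hx, Set.mem_singleton_iff] at this
  simpa using this

/-- If the columns in the support of an optimal solution are dependent, then there is an optimal
solution with smaller support whose `i`-th coordinate is not smaller. -/
theorem exists_posSet_ssubset {b : Fin m → ℝ} {x : Fin d → ℝ} (hx : optSet A c b = {x})
    {y : Fin d → ℝ} (hy : y ∈ optSet A c v) (hdep : ¬ LinearIndepOn ℝ A.col (posSet y))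
    (i : Fin d) : ∃ z ∈ optSet A c v, posSet z ⊂ posSet y ∧ (0 < y i → 0 < z i) := by
  classical
  have hzero : ∀ j, j ∉ posSet y → y j = 0 := fun j hj => le_antisymm (not_lt.1 hj) (hy.1.2 j)
  obtain ⟨w, hw0, hsupp, hAw⟩ : ∃ w : Fin d → ℝ, w ≠ 0 ∧ (∀ j, y j = 0 → w j = 0) ∧
      A *ᵥ w = 0 := by
    rw [← Set.coe_toFinset (posSet y), linearIndepOn_finset_iff] at hdep
    push Not at hdep
    obtain ⟨f, hf, k, hk, hfk⟩ := hdep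
    refine ⟨fun j => if j ∈ posSet y then f j else 0, fun h => hfk ?_, fun j hj => ?_, ?_⟩
    · have := congrFun h k
      simpa [Set.mem_toFinset.1 hk] using this
    · simp [posSet, hj]
    · funext r
      have := congrFun hf r
      simp only [Finset.sum_apply, Pi.smul_apply, smul_eq_mul, Pi.zero_apply] at this
      refine Eq.trans ?_ this
      refine (Finset.sum_subset (Finset.subset_univ (posSet y).toFinset) ?_).symm.trans ?_
      rotate_left
      · refine Finset.sum_congr rfl fun j hj => ?_
        change A r j * (if j ∈ posSet y then f j else 0) = f j * A r j
        rw [if_pos (Set.mem_toFinset.1 hj), mul_comm]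
      · intro j _ hj
        change A r j * (if j ∈ posSet y then f j else 0) = 0
        rw [if_neg (by simpa using hj), mul_zero]
  have hcw : c ⬝ᵥ w = 0 := by
    have h1 := dotProduct_nonneg_of_mem_optSet hy hAw fun j hj => (hsupp j hj).ge
    have h2 := dotProduct_nonneg_of_mem_optSet hy (w := -w) (by rw [mulVec_neg, hAw, neg_zero])
      fun j hj => by simp [hsupp j hj]
    rw [dotProduct_neg] at h2
    linarith
  -- The sign is chosen so that moving along `u` does not decrease coordinate `i`; the move stops
  -- when the first coordinate reaches zero.
  obtain ⟨u, hu0, hus, hAu, hcu, hui⟩ : ∃ u : Fin d → ℝ, u ≠ 0 ∧ (∀ j, y j = 0 → u j = 0) ∧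
      A *ᵥ u = 0 ∧ c ⬝ᵥ u = 0 ∧ 0 ≤ u i := by
    rcases le_total 0 (w i) with h | h
    · exact ⟨w, hw0, hsupp, hAw, hcw, h⟩
    · exact ⟨-w, neg_ne_zero.2 hw0, fun j hj => by simp [hsupp j hj],
        by rw [mulVec_neg, hAw, neg_zero], by rw [dotProduct_neg, hcw, neg_zero], by simpa using h⟩
  obtain ⟨j₁, hj₁⟩ : ∃ j, u j < 0 := by
    by_contra hcon
    push Not at hcon
    exact hu0 (eq_zero_of_ray hx hcon hAu hcu)
  let F : Finset (Fin d) := Finset.univ.filter fun j => u j < 0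
  obtain ⟨j₀, hj₀, hmin⟩ := Finset.exists_min_image F (fun j => y j / (-u j))
    ⟨j₁, by simp [F, hj₁]⟩
  have hj₀' : u j₀ < 0 := by simpa [F] using hj₀
  set t := y j₀ / (-u j₀) with ht
  have ht0 : 0 ≤ t := div_nonneg (hy.1.2 j₀) (by linarith)
  have hz0 : (y + t • u) j₀ = 0 := by
    rw [Pi.add_apply, Pi.smul_apply, smul_eq_mul, ht]
    rw [div_neg, neg_mul, div_mul_cancel₀ _ hj₀'.ne, add_neg_cancel]
  refine ⟨y + t • u, ⟨⟨?_, fun j => ?_⟩, fun z hz => ?_⟩, ?_, fun hi => ?_⟩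
  · rw [mulVec_add, mulVec_smul, hAu, smul_zero, add_zero, hy.1.1]
  · rw [Pi.add_apply, Pi.smul_apply, smul_eq_mul, Pi.zero_apply]
    have h1 := hy.1.2 j
    rw [Pi.zero_apply] at h1
    by_cases hj : u j < 0
    · have := hmin j (by simp [F, hj])
      rw [le_div_iff₀ (by linarith)] at this
      linarith
    · have := mul_nonneg ht0 (not_lt.1 hj)
      linarith
  · rw [dotProduct_add, dotProduct_smul, hcu, smul_zero, add_zero]
    exact hy.2 z hz
  · refine ⟨fun j hj => ?_, fun hcon => ?_⟩
    · by_contra hjy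
      have h0 := hzero j hjy
      have hj' : 0 < (y + t • u) j := hj
      rw [Pi.add_apply, Pi.smul_apply, h0, hus j h0, smul_zero, add_zero] at hj'
      exact lt_irrefl _ hj'
    · have hj₀y : j₀ ∈ posSet y := by
        by_contra h
        exact hj₀'.ne (hus j₀ (hzero j₀ h))
      have : 0 < (y + t • u) j₀ := hcon hj₀y
      exact this.ne' hz0
  · rw [Pi.add_apply, Pi.smul_apply, smul_eq_mul]
    have := mul_nonneg ht0 hui
    linarith

/-- For every optimal solution `y` and every index `i` there is a basic optimal solution, given by a
dual feasible basis and supported in the support of `y`, whose support contains `i` if that of `y`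
does. -/
theorem exists_dualFeasible_posSet (hA : A.rank = m) {b : Fin m → ℝ} {x : Fin d → ℝ}
    (hx : optSet A c b = {x}) {y : Fin d → ℝ} (hy : y ∈ optSet A c v) (i : Fin d) :
    ∃ I : LPBasis A, I.DualFeasible c ∧ I.PrimalFeasible v ∧
      posSet (I.primalSol v) ⊆ posSet y ∧ (0 < y i → 0 < I.primalSol v i) := by
  obtain ⟨z, hz, hmin⟩ := Set.Finite.exists_minimalFor' posSet
    {z | z ∈ optSet A c v ∧ posSet z ⊆ posSet y ∧ (0 < y i → 0 < z i)} (Set.toFinite _)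
    ⟨y, hy, subset_rfl, id⟩
  have hind : LinearIndepOn ℝ A.col (posSet z) := by
    by_contra hdep
    obtain ⟨z', hz', hss, hi⟩ := exists_posSet_ssubset hx hz.1 hdep i
    exact hss.2 (hmin ⟨hz', hss.1.trans hz.2.1, fun h => hi (hz.2.2 h)⟩ hss.1)
  obtain ⟨I, hD, hP, rfl, -⟩ := exists_dualFeasible_of_linearIndepOn hA hz.1 hind
  exact ⟨I, hD, hP, hz.2⟩

/-! ### Stability of bases and supports near `b` -/

theorem mem_optBases {b : Fin m → ℝ} {I : LPBasis A} :
    I ∈ optBases A c b ↔ I.DualFeasible c ∧ I.PrimalFeasible b := by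
  classical
  simp [optBases]

theorem primalSol_eq_of_mem_optBases {b : Fin m → ℝ} {x : Fin d → ℝ} (hx : optSet A c b = {x})
    {I : LPBasis A} (hI : I ∈ optBases A c b) : I.primalSol b = x := by
  rw [mem_optBases] at hI
  have := hI.1.primalSol_mem_optSet hI.2
  rwa [hx] at this

/-- Close to `b`, only the bases that are primal feasible for `b` can be primal feasible. -/
theorem eventually_mem_optBases (A : Matrix (Fin m) (Fin d) ℝ) (c : Fin d → ℝ) (b : Fin m → ℝ) :
    ∀ᶠ v in 𝓝 b, ∀ I : LPBasis A, I.DualFeasible c → I.PrimalFeasible v → I ∈ optBases A c b := by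
  refine eventually_all.2 fun I => ?_
  by_cases hb : I.PrimalFeasible b
  · exact Eventually.of_forall fun v hD _ => mem_optBases.2 ⟨hD, hb⟩
  · have hopen : IsOpen {v | ¬ I.PrimalFeasible v} :=
      (isClosed_le continuous_const I.continuous_primalSol).isOpen_compl
    filter_upwards [hopen.mem_nhds hb] with v hv _ hP
    exact absurd hP hv

/-- Close to `b`, optimal solutions vanish on the true zeros and are positive where `x` is. -/
theorem eventually_optSet_support (hA : A.rank = m) {b : Fin m → ℝ} {x : Fin d → ℝ}
    (hx : optSet A c b = {x}) :
    ∀ᶠ v in 𝓝 b, ∀ y ∈ optSet A c v,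
      (∀ i ∈ trueZeros A c b x, y i = 0) ∧ ∀ i ∈ posSet x, 0 < y i := by
  have hpos : ∀ᶠ v in 𝓝 b, ∀ I : LPBasis A, ∀ i : Fin d, I ∈ optBases A c b → i ∈ posSet x →
      0 < I.primalSol v i := by
    refine eventually_all.2 fun I => eventually_all.2 fun i => ?_
    by_cases hI : I ∈ optBases A c b ∧ i ∈ posSet x
    · have h0 : 0 < I.primalSol b i := by
        rw [primalSol_eq_of_mem_optBases hx hI.1]; exact hI.2
      filter_upwards [(I.continuous_primalSol_apply i).tendsto b |>.eventually (lt_mem_nhds h0)]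
        with v hv _ _ using hv
    · exact Eventually.of_forall fun v h1 h2 => absurd ⟨h1, h2⟩ hI
  filter_upwards [eventually_mem_optBases A c b, hpos] with v h1 h2 y hy
  refine ⟨fun i hi => ?_, fun i hi => ?_⟩
  · by_contra hne
    have hyi : 0 < y i := lt_of_le_of_ne (hy.1.2 i) (Ne.symm hne)
    obtain ⟨I, hD, hP, -, hIi⟩ := exists_dualFeasible_posSet hA hx hy i
    refine hi ⟨I, hD, (primalSol_eq_of_mem_optBases hx (h1 I hD hP)).symm, ?_⟩
    by_contra hiI
    exact (hIi hyi).ne' (I.primalSol_of_notMem v hiI)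
  · obtain ⟨I, hD, hP, hsub, -⟩ := exists_dualFeasible_posSet hA hx hy i
    exact hsub (h2 I i (h1 I hD hP) hi)

end Deterministic

end StochLP

namespace StochLP

/-! ### Convergence in probability -/

section Stochastic

variable {m d : ℕ} {Ω Ω' : Type*} [MeasurableSpace Ω] [MeasurableSpace Ω']

/-- The random right-hand sides converge to `b` in probability. -/
theorem AssumptionB1.tendsto_measure_mem {b : Fin m → ℝ} {m₀ : ℕ} {hm₀ : m₀ ≤ m} {r : ℕ → ℝ}
    {bn : ℕ → Ω → Fin m → ℝ} {G : Ω' → Fin m → ℝ}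
    {P : Measure Ω} [IsProbabilityMeasure P] {P' : Measure Ω'} [IsProbabilityMeasure P']
    (h : AssumptionB1 b m₀ hm₀ r bn G P P') {U : Set (Fin m → ℝ)} (hU : IsOpen U) (hb : b ∈ U) :
    Tendsto (fun n => P {ω | bn n ω ∈ U}) atTop (𝓝 1) := by
  have hinv : Tendsto (fun n => (r n)⁻¹) atTop (𝓝 0) := tendsto_inv_atTop_zero.comp h.rate
  have hY : TendstoInMeasure P (fun n (_ : Ω) => (r n)⁻¹) atTop (fun _ => (0 : ℝ)) :=
    tendstoInMeasure_of_tendsto_ae (fun n => aestronglyMeasurable_const)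
      -- Slutsky's theorem with `(r n)⁻¹ → 0`: the limit law is the point mass at `b`, and the
      -- portmanteau theorem applies to `U`.
      (Eventually.of_forall fun _ => hinv)
  have hd := h.tendsto.continuous_comp_prodMk_of_tendstoInMeasure_const
    (g := fun p : (Fin m → ℝ) × ℝ => b + p.2 • p.1) (by fun_prop) hY
    (fun n => aemeasurable_const)
  have hport := ProbabilityMeasure.le_liminf_measure_open_of_tendsto hd.tendsto hU
  have hlim : (P'.map fun ω => b + (0 : ℝ) • G ω) U = 1 := by
    rw [Measure.map_apply (by simp) hU.measurableSet]
    simp [hb]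
  have hev : (fun n => (P.map fun ω => b + (r n)⁻¹ • r n • (bn n ω - b)) U) =ᶠ[atTop]
      fun n => P {ω | bn n ω ∈ U} := by
    filter_upwards [h.rate.eventually_ne_atTop 0] with n hn
    have : (fun ω => b + (r n)⁻¹ • r n • (bn n ω - b)) = bn n := by
      funext ω
      rw [inv_smul_smul₀ hn, add_sub_cancel]
    rw [this, Measure.map_apply (h.measurable_bn n) hU.measurableSet]
    rfl
  refine tendsto_of_le_liminf_of_limsup_le ?_ ?_
  · rw [← liminf_congr hev, ← hlim]
    exact hport
  · exact limsup_le_of_le (by isBoundedDefault) (Eventually.of_forall fun n => prob_le_one)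

/-- Only `t n` has to be measurable, so `s n` can be the event that an optimal solution exists. -/
theorem tendsto_measure_of_inter_subset {P : Measure Ω} [IsProbabilityMeasure P]
    {s t u : ℕ → Set Ω} (hs : Tendsto (fun n => P (s n)) atTop (𝓝 1))
    (ht : Tendsto (fun n => P (t n)) atTop (𝓝 1)) (htm : ∀ n, MeasurableSet (t n))
    (hu : ∀ n, s n ∩ t n ⊆ u n) : Tendsto (fun n => P (u n)) atTop (𝓝 1) := by
  have htc : Tendsto (fun n => P (t n)ᶜ) atTop (𝓝 0) := by
    simp_rw [fun n => prob_compl_eq_one_sub (μ := P) (htm n)]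
    simpa using ENNReal.Tendsto.sub tendsto_const_nhds ht (Or.inl ENNReal.one_ne_top)
  have hsub := ENNReal.Tendsto.sub hs htc (Or.inl ENNReal.one_ne_top)
  rw [tsub_zero] at hsub
  refine tendsto_of_tendsto_of_tendsto_of_le_of_le hsub tendsto_const_nhds (fun n => ?_)
    fun n => prob_le_one
  refine tsub_le_iff_right.2 ((measure_mono fun ω hω => ?_).trans (measure_union_le (u n) (t n)ᶜ))
  by_cases h : ω ∈ t n
  exacts [Or.inl (hu n ⟨hω, h⟩), Or.inr h]

end Stochastic

/-! ### Cones and regions -/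

section Cones

variable {m d : ℕ} {A : Matrix (Fin m) (Fin d) ℝ} {c : Fin d → ℝ} {b v : Fin m → ℝ}
  {x : Fin d → ℝ}

theorem mem_cone {I : LPBasis A} : v ∈ cone x I ↔ ∀ i ∉ posSet x, 0 ≤ I.primalSol v i := by
  refine ⟨fun h i hi => ?_, fun h j hj => ?_⟩
  · by_cases hiI : i ∈ I.idx
    · rw [← Finset.mem_coe, ← I.range_emb] at hiI
      obtain ⟨k, rfl⟩ := hiI
      rw [I.primalSol_emb]
      exact h k hi
    · rw [I.primalSol_of_notMem v hiI]
  · rw [← I.primalSol_emb]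
    exact h _ hj

theorem measurableSet_cone (x : Fin d → ℝ) (I : LPBasis A) : MeasurableSet (cone x I) := by
  have : cone x I = ⋂ i, ⋂ (_ : i ∉ posSet x), {v | 0 ≤ I.primalSol v i} := by
    ext v; simp [mem_cone]
  rw [this]
  exact MeasurableSet.iInter fun i => MeasurableSet.iInter fun _ =>
    (isClosed_le continuous_const (I.continuous_primalSol_apply i)).measurableSet

theorem mem_region {𝒦 : Finset (LPBasis A)} :
    v ∈ region A c b x 𝒦 ↔
      (∀ I ∈ 𝒦, v ∈ cone x I) ∧ ∀ I ∈ optBases A c b, I ∉ 𝒦 → v ∉ cone x I := by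
  simp [region]

theorem measurableSet_region (𝒦 : Finset (LPBasis A)) : MeasurableSet (region A c b x 𝒦) :=
  (Finset.measurableSet_biInter 𝒦 fun I _ => measurableSet_cone x I).diff
    (MeasurableSet.biUnion (Set.to_countable _) fun I _ => measurableSet_cone x I)

theorem mem_basisSubsets {𝒦 : Finset (LPBasis A)} :
    𝒦 ∈ basisSubsets A c b ↔ 𝒦 ⊆ optBases A c b ∧ 𝒦.Nonempty := by
  simp [basisSubsets]

/-- On the intersection of two cones, the corresponding dual solutions agree. -/
theorem dualSol_dotProduct_eq (hx : optSet A c b = {x}) {I J : LPBasis A}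
    (hI : I ∈ optBases A c b) (hJ : J ∈ optBases A c b) (hvI : v ∈ cone x I) (hvJ : v ∈ cone x J) :
    I.dualSol c ⬝ᵥ v = J.dualSol c ⬝ᵥ v := by
  have hx0 : 0 ≤ x := by
    have : x ∈ optSet A c b := by rw [hx]; rfl
    exact this.1.2
  have key : ∀ {I J : LPBasis A}, I ∈ optBases A c b → J ∈ optBases A c b → v ∈ cone x J →
      I.dualSol c ⬝ᵥ v ≤ J.dualSol c ⬝ᵥ v := fun {I J} hI hJ hv => by
    -- For small `t` the basis `J` is optimal for `b + t • v`; weak duality with `I` there, after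
    -- cancelling the common value at `b`, compares the two duals at `v`.
    obtain ⟨t, ht, htJ⟩ := exists_pos_add_smul_nonneg (w := J.primalSol v) hx0 fun i hi =>
      mem_cone.1 hv i fun h => (show 0 < x i from h).ne' hi
    have hJx := primalSol_eq_of_mem_optBases hx hJ
    have hIx := primalSol_eq_of_mem_optBases hx hI
    have hPJ : J.PrimalFeasible (b + t • v) := by
      rw [LPBasis.PrimalFeasible, J.primalSol_add, J.primalSol_smul, hJx]
      exact htJ
    have hle := (mem_optBases.1 hI).1.dualSol_dotProduct_le (v := b + t • v)
      ⟨J.mulVec_primalSol _, hPJ⟩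
    have hb : I.dualSol c ⬝ᵥ b = J.dualSol c ⬝ᵥ b := by
      rw [← I.dotProduct_primalSol, ← J.dotProduct_primalSol, hIx, hJx]
    rw [J.dotProduct_primalSol, dotProduct_add, dotProduct_add, hb, dotProduct_smul,
      dotProduct_smul, smul_eq_mul, smul_eq_mul] at hle
    exact le_of_mul_le_mul_left (by linarith) ht
  exact le_antisymm (key hI hJ hvJ) (key hJ hI hvI)

theorem volume_ker_eq_zero {f : (Fin m → ℝ) →ₗ[ℝ] ℝ} (hf : f ≠ 0) :
    volume {v | f v = 0} = 0 :=
  Measure.addHaar_submodule volume (LinearMap.ker f) fun h => hf (LinearMap.ker_eq_top.1 h)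

theorem volume_cone_inter_cone (hx : optSet A c b = {x}) {I J : LPBasis A}
    (hI : I ∈ optBases A c b) (hJ : J ∈ optBases A c b) (hne : I.dualSol c ≠ J.dualSol c) :
    volume (cone x I ∩ cone x J) = 0 := by
  refine measure_mono_null (fun v hv => ?_) (volume_ker_eq_zero
    (f := dotProductEquiv ℝ (Fin m) (I.dualSol c - J.dualSol c)) fun h => ?_)
  · rw [Set.mem_ofPred_eq, dotProductEquiv_apply_apply, sub_dotProduct, sub_eq_zero]
    exact dualSol_dotProduct_eq hx hI hJ hv.1 hv.2
  · rw [LinearEquiv.map_eq_zero_iff, sub_eq_zero] at h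
    exact hne h

/-- The right-hand side `t ∑_{i ∈ I} A_i` has the basic solution with all entries on `I` equal to
`t`. -/
theorem primalSol_mulVec_indicator (I : LPBasis A) (t : ℝ) {i : Fin d} (hi : i ∈ I.idx) :
    I.primalSol (t • A *ᵥ (I.idx : Set (Fin d)).indicator 1) i = t := by
  rw [I.primalSol_smul, ← I.eq_primalSol (y := (I.idx : Set (Fin d)).indicator 1)
    (fun i hi => by simp [hi]) rfl]
  simp [hi]

theorem volume_primalSol_eq_zero (I : LPBasis A) {i : Fin d} (hi : i ∈ I.idx) :
    volume {v | I.primalSol v i = 0} = 0 := by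
  refine volume_ker_eq_zero (f := I.primalCoord i) fun h => ?_
  have h1 := primalSol_mulVec_indicator I 1 hi
  rw [← I.primalCoord_apply, h] at h1
  simp at h1

/-- The positivity set is open and contains small positive multiples of the sum of the basis
columns. -/
theorem volume_inter_pos (I : LPBasis A) {U : Set (Fin m → ℝ)} (hU : U ∈ 𝓝 0) :
    0 < volume ({v | ∀ i ∈ I.idx, 0 < I.primalSol v i} ∩ U) := by
  have hopen : IsOpen {v | ∀ i ∈ I.idx, 0 < I.primalSol v i} := by
    simp only [Set.ofPred_forall]
    exact isOpen_biInter_finset fun i _ =>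
      isOpen_lt continuous_const (I.continuous_primalSol_apply i)
  have hW : Tendsto (fun t : ℝ => t • A *ᵥ (I.idx : Set (Fin d)).indicator 1) (𝓝[>] 0) (𝓝 0) := by
    have : Continuous fun t : ℝ => t • A *ᵥ (I.idx : Set (Fin d)).indicator 1 := by fun_prop
    simpa using (this.tendsto 0).mono_left nhdsWithin_le_nhds
  obtain ⟨t, htU, ht⟩ :=
    ((hW.eventually (interior_mem_nhds.2 hU)).and self_mem_nhdsWithin).exists
  refine ((hopen.inter isOpen_interior).measure_pos volume
    ⟨_, fun i hi => ?_, htU⟩).trans_le (measure_mono (Set.inter_subset_inter_right _ interior_subset))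
  rw [primalSol_mulVec_indicator I t hi]
  exact ht

end Cones

/-! ### Positivity of the limit -/

section Limit

variable {m d : ℕ} {A : Matrix (Fin m) (Fin d) ℝ} {c : Fin d → ℝ} {b : Fin m → ℝ}
  {x : Fin d → ℝ} {Ω' : Type*} [MeasurableSpace Ω'] {G : Ω' → Fin m → ℝ}
  {α : ∀ 𝒦 : Finset (LPBasis A), Ω' → 𝒦 → ℝ} {P' : Measure Ω'}

theorem weightsNotConcentrated_of_assumptionA3 [IsFiniteMeasure P']
    (hx : optSet A c b = {x}) (hG : Measurable G)
    (hac : P'.map G ≪ volume) (hA3 : AssumptionA3 A c b) :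
    WeightsNotConcentrated A c b x G α P' := by
  intro 𝒦 h𝒦 hpos S hS hae
  rw [mem_basisSubsets] at h𝒦
  obtain ⟨I, hI⟩ := h𝒦.2
  have huniq : ∀ J ∈ 𝒦, J = I := fun J hJ => by
    by_contra hne
    refine hpos (measure_mono_null (fun ω hω => ?_) ?_ (t := G ⁻¹' (cone x I ∩ cone x J)))
    · exact ⟨(mem_region.1 hω).1 I hI, (mem_region.1 hω).1 J hJ⟩
    · rw [← Measure.map_apply hG ((measurableSet_cone x I).inter (measurableSet_cone x J))]
      exact hac (volume_cone_inter_cone hx (h𝒦.1 hI) (h𝒦.1 hJ)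
        (hA3 I (h𝒦.1 hI) J (h𝒦.1 hJ) (Ne.symm hne)))
  have : IsProbabilityMeasure P'[|{ω | G ω ∈ region A c b x 𝒦}] := cond_isProbabilityMeasure hpos
  obtain ⟨ω, hω⟩ := hae.exists
  -- As `𝒦` is a singleton, a proper `S` is empty, and weights vanishing off `S` cannot sum to one.
  have hall : ∀ k : 𝒦, k ∉ S := by
    obtain ⟨k, hk⟩ := (Set.ne_univ_iff_exists_notMem S).1 hS
    intro l hl
    have : l = k := Subtype.ext ((huniq _ l.2).trans (huniq _ k.2).symm)
    exact hk (this ▸ hl)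
  have hsum := hω.1.2
  rw [Finset.sum_eq_zero fun k _ => hω.2 k (hall k)] at hsum
  exact zero_ne_one hsum

theorem mix_apply_nonneg {𝒦 : Finset (LPBasis A)} {a : 𝒦 → ℝ} (ha : ∀ k, 0 ≤ a k)
    {v : Fin m → ℝ} (hv : v ∈ region A c b x 𝒦) {i : Fin d} (hi : i ∉ posSet x) :
    ∀ k : 𝒦, 0 ≤ (a k • k.1.primalSol v) i := fun k =>
  mul_nonneg (ha k) (mem_cone.1 ((mem_region.1 hv).1 k k.2) i hi)

theorem limitMap_apply_pos {a : ∀ 𝒦 : Finset (LPBasis A), 𝒦 → ℝ}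
    (ha : ∀ 𝒦 ∈ basisSubsets A c b, ∀ k, 0 ≤ a 𝒦 k) {v : Fin m → ℝ}
    {𝒦 : Finset (LPBasis A)} (h𝒦 : 𝒦 ∈ basisSubsets A c b) (hv : v ∈ region A c b x 𝒦)
    {i : Fin d} (hi : i ∉ posSet x) {k : 𝒦} (hak : 0 < a 𝒦 k) (hk : 0 < k.1.primalSol v i) :
    0 < limitMap A c b x a v i := by
  classical
  rw [limitMap, Finset.sum_apply]
  refine Finset.sum_pos' (fun ℒ hℒ => ?_) ⟨𝒦, h𝒦, ?_⟩
  · split_ifs with h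
    · rw [mix, Finset.sum_apply]
      exact Finset.sum_nonneg fun k _ => mix_apply_nonneg (ha ℒ hℒ) h hi k
    · exact le_rfl
  · rw [if_pos hv, mix, Finset.sum_apply]
    exact Finset.sum_pos' (fun k _ => mix_apply_nonneg (ha 𝒦 h𝒦) hv hi k)
      ⟨k, Finset.mem_univ _, mul_pos hak hk⟩

/-- Every cone `H_I` contains a region of positive probability. -/
theorem exists_region_measure_ne_zero (hG : Measurable G) (hdens : DensityPosNearZero G P')
    {I : LPBasis A} (hI : I ∈ optBases A c b) :
    ∃ 𝒦 ∈ basisSubsets A c b, I ∈ 𝒦 ∧ P' {ω | G ω ∈ region A c b x 𝒦} ≠ 0 := by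
  classical
  obtain ⟨U, hU, hpos⟩ := hdens
  set W := {v | ∀ i ∈ I.idx, 0 < I.primalSol v i} ∩ U with hWdef
  have hW : P'.map G W ≠ 0 := by
    refine (lt_of_lt_of_le ?_ (Measure.setLIntegral_rnDeriv_le W (ν := volume))).ne'
    rw [setLIntegral_pos_iff (Measure.measurable_rnDeriv _ _), pos_iff_ne_zero]
    intro h0
    refine (volume_inter_pos I hU).ne' ?_
    rw [measure_eq_zero_iff_ae_notMem] at h0 ⊢
    filter_upwards [h0, hpos] with v h1 h2 h3
    exact h1 ⟨(h2 h3.2).ne', h3⟩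
  by_contra hcon
  push Not at hcon
  refine hW (measure_mono_null (fun v hv => ?_) ((measure_biUnion_null_iff
    ((basisSubsets A c b).filter fun 𝒦 => I ∈ 𝒦).countable_toSet
    (s := fun 𝒦 => region A c b x 𝒦)).2 fun 𝒦 h𝒦 => ?_))
  · have hvI : v ∈ cone x I := mem_cone.2 fun i _ => by
      by_cases hi : i ∈ I.idx
      · exact (hv.1 i hi).le
      · rw [I.primalSol_of_notMem v hi]
    -- The regions partition the union of the cones: `v` lies in the one indexed by all cones
    -- containing it.
    let 𝒦 := (optBases A c b).filter fun J => v ∈ cone x J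
    have hI𝒦 : I ∈ 𝒦 := Finset.mem_filter.2 ⟨hI, hvI⟩
    refine Set.mem_biUnion (x := 𝒦) ?_ (mem_region.2 ⟨fun J hJ => (Finset.mem_filter.1 hJ).2,
      fun J hJ hJ𝒦 hvJ => hJ𝒦 (Finset.mem_filter.2 ⟨hJ, hvJ⟩)⟩)
    exact Finset.mem_coe.2 (Finset.mem_filter.2
      ⟨mem_basisSubsets.2 ⟨Finset.filter_subset _ _, I, hI𝒦⟩, hI𝒦⟩)
  · have h := Finset.mem_filter.1 (Finset.mem_coe.1 h𝒦)
    rw [Measure.map_apply hG (measurableSet_region 𝒦)]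
    exact hcon 𝒦 h.1 h.2

theorem measure_limitMap_pos (hx : optSet A c b = {x}) (hG : Measurable G)
    (hac : P'.map G ≪ volume) (hdens : DensityPosNearZero G P')
    (hα : ∀ 𝒦 ∈ basisSubsets A c b, ∀ ω, α 𝒦 ω ∈ stdSimplex ℝ 𝒦)
    (hNC : WeightsNotConcentrated A c b x G α P') {i : Fin d} (hi : i ∈ degZeros A c b x) :
    0 < P' {ω | 0 < limitMap A c b x (fun 𝒦 => α 𝒦 ω) (G ω) i} := by
  obtain ⟨⟨I, hD, hxI, hiI⟩, hi⟩ := hi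
  have hxo : x ∈ optSet A c b := by rw [hx]; rfl
  have hI : I ∈ optBases A c b := mem_optBases.2 ⟨hD, by
    rw [LPBasis.PrimalFeasible, ← hxI]; exact hxo.1.2⟩
  obtain ⟨𝒦, h𝒦, hI𝒦, hpos⟩ := exists_region_measure_ne_zero (x := x) hG hdens hI
  rw [pos_iff_ne_zero]
  intro h0
  have hnull : ∀ᵐ ω ∂P', I.primalSol (G ω) i ≠ 0 := by
    have h1 := hac (volume_primalSol_eq_zero I hiI)
    rw [Measure.map_apply hG
      (isClosed_eq (I.continuous_primalSol_apply i) continuous_const).measurableSet] at h1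
    exact measure_eq_zero_iff_ae_notMem.1 h1
  -- A positive weight on `I` would make the limit positive at `i`, since `x(I, G)_i` is
  -- non-negative on the region and almost surely non-zero.
  have hae : ∀ᵐ ω ∂P', G ω ∈ region A c b x 𝒦 → α 𝒦 ω ∈ simplexFace {(⟨I, hI𝒦⟩ : 𝒦)}ᶜ := by
    filter_upwards [hnull, measure_eq_zero_iff_ae_notMem.1 h0] with ω h1 h2 h3
    refine ⟨hα 𝒦 h𝒦 ω, fun k hk => ?_⟩
    rw [Set.notMem_compl_iff, Set.mem_singleton_iff] at hk
    subst hk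
    by_contra hne
    refine h2 (limitMap_apply_pos (fun ℒ hℒ => (hα ℒ hℒ ω).1) h𝒦 h3 hi
      (lt_of_le_of_ne ((hα 𝒦 h𝒦 ω).1 _) (Ne.symm hne)) (lt_of_le_of_ne ?_ (Ne.symm h1)))
    exact mem_cone.1 ((mem_region.1 h3).1 I hI𝒦) i hi
  refine hNC 𝒦 h𝒦 hpos {(⟨I, hI𝒦⟩ : 𝒦)}ᶜ (fun h => ?_) ?_
  · have : (⟨I, hI𝒦⟩ : 𝒦) ∈ ({(⟨I, hI𝒦⟩ : 𝒦)}ᶜ : Set 𝒦) := h ▸ Set.mem_univ _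
    exact this rfl
  · have hm : MeasurableSet {ω | G ω ∈ region A c b x 𝒦} := hG (measurableSet_region 𝒦)
    filter_upwards [ae_cond_mem hm, cond_absolutelyContinuous.ae_le hae] with ω h1 h2
    exact h2 h1

end Limit

end StochLP

theorem theorem3p5
    {m d m₀ : ℕ} (hm₀_pos : 1 ≤ m₀) (hm₀ : m₀ ≤ m)
    (A : Matrix (Fin m) (Fin d) ℝ) (hA : A.rank = m)
    (c : Fin d → ℝ) (b : Fin m → ℝ)
    -- the program with right-hand side `b` has the unique optimal solution `x`
    (x : Fin d → ℝ) (hA2 : StochLP.optSet A c b = {x})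
    {Ω Ω' : Type*} [MeasurableSpace Ω] [MeasurableSpace Ω']
    (P : Measure Ω) [IsProbabilityMeasure P] (P' : Measure Ω') [IsProbabilityMeasure P']
    (r : ℕ → ℝ) (bn : ℕ → Ω → Fin m → ℝ) (G : Ω' → Fin m → ℝ)
    (hB1 : StochLP.AssumptionB1 b m₀ hm₀ r bn G P P')
    (hB2 : StochLP.AssumptionB2 A c bn P)
    (xn : ℕ → Ω → Fin d → ℝ) (hxn : StochLP.IsEmpiricalSolution A c bn xn) :
    Tendsto (fun n => P {ω | ∀ i ∈ StochLP.trueZeros A c b x, xn n ω i = 0}) atTop (𝓝 1) ∧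
    Tendsto (fun n => P {ω | ∀ i ∈ StochLP.posSet x, 0 < xn n ω i}) atTop (𝓝 1) ∧
    (m₀ = m →
      ∀ (αn : ℕ → ∀ 𝒦 : Finset (StochLP.LPBasis A), Ω → 𝒦 → ℝ)
        (α : ∀ 𝒦 : Finset (StochLP.LPBasis A), Ω' → 𝒦 → ℝ),
        StochLP.IsWeightLimit A c b r bn xn G αn α P P' →
        (StochLP.AssumptionA3 A c b → StochLP.WeightsNotConcentrated A c b x G α P') ∧
        (StochLP.DensityPosNearZero G P' → StochLP.WeightsNotConcentrated A c b x G α P' →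
          ∀ i ∈ StochLP.degZeros A c b x,
            0 < P' {ω | 0 < StochLP.limitMap A c b x (fun 𝒦 => α 𝒦 ω) (G ω) i})) := by
  obtain ⟨U, hU, hUo, hbU⟩ := mem_nhds_iff.1 (StochLP.eventually_optSet_support hA hA2)
  have hbn := hB1.tendsto_measure_mem hUo hbU
  have hm : ∀ n, MeasurableSet {ω | bn n ω ∈ U} := fun n =>
    hB1.measurable_bn n hUo.measurableSet
  refine ⟨?_, ?_, ?_⟩
  · exact StochLP.tendsto_measure_of_inter_subset hB2 hbn hm fun n ω hω =>
      (hU hω.2 _ (hxn.mem_optSet n ω hω.1)).1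
  · exact StochLP.tendsto_measure_of_inter_subset hB2 hbn hm fun n ω hω =>
      (hU hω.2 _ (hxn.mem_optSet n ω hω.1)).2
  · rintro rfl αn α hw
    -- With `m₀ = m` the map `Fin.castLE` is the identity, so the assumption concerns the law of `G`
    -- itself.
    have hac : P'.map G ≪ volume := hB1.abs_cont
    exact ⟨StochLP.weightsNotConcentrated_of_assumptionA3 hA2 hB1.measurable_G hac,
      fun hdens hNC i hi => StochLP.measure_limitMap_pos hA2 hB1.measurable_G hac hdens
        hw.limit_mem hNC hi⟩
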